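/- **Theorem 1 (Generalized Grothendieck inequality in dual tensor form).** Let $\mathcal X,\mathcal Y,\mathcal A,\mathcal B$ be finite sets. Let $\ell_\infty^{|\mathcal X|}(\ell_1^{|\mathcal A|})$ and $\ell_1^{|\mathcal X|}(\ell_\infty^{|\mathcal A|})$ be the space $\mathbb R^{\mathcal X\times\mathcal A}$ with the norm $\|P\|_{\infty(1)}=\max_x\sum_a|P_{x,a}|$, respectively $\|G\|_{1(\infty)}=\sum_x\max_a|G_{x,a}|$; they are dual to each other through $\langle G,P\rangle=\sum_{x,a}G_{x,a}P_{x,a}$. The tensor products are paired by $\langle G_A\otimes G_B,P_A\otimes P_B\rangle=\langle G_A,P_A\rangle\langle G_B,P_B\rangle$, extended bilinearly. The injective norm of $G\in\ell_1^{|\mathcal X|}(\ell_\infty^{|\mathcal A|})\otimes\ell_1^{|\mathcal Y|}(\ell_\infty^{|\mathcal B|})$ is $$\varepsilon(G)=\sup\{|\langle G,P_A\otimes P_B\rangle|:\|P_A\|_{\infty(1)}\le1,\ \|P_B\|_{\infty(1)}\le1\}.$$ The Hilbertian tensor norm of $P\in\ell_\infty^{|\mathcal X|}(\ell_1^{|\mathcal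 A|})\otimes\ell_\infty^{|\mathcal Y|}(\ell_1^{|\mathcal B|})$ is $$\gamma_2(P)=\inf\Big\{w_2\big((P_A^i)_i\big)\,w_2\big((P_B^i)_i\big):P=\sum_{i=1}^nP_A^i\otimes P_B^i\Big\},$$ where the infimum is over all finite decompositions and $$w_2\big((P_A^i)_i\big)=\sup_{\|G_A\|_{1(\infty)}\le1}\Big(\sum_i|\langle G_A,P_A^i\rangle|^2\Big)^{1/2},$$ and similarly for $(P_B^i)_i$. The dual Hilbertian tensor norm is $$\gamma_2^*(G)=\sup\{|\langle G,P\rangle|:\gamma_2(P)\le1\}.$$ Put $K=\frac{\pi}{2\ln(1+\sqrt2)}$. Then for every real tensor $G\in\ell_1^{|\mathcal X|}(\ell_\infty^{|\mathcal A|})\otimes\ell_1^{|\mathcal Y|}(\ell_\infty^{|\mathcal B|})$ (negative entries allowed) the supremum $\gamma_2^*(G)$ is finite and $$\gamma_2^*(G)\le K\sqrt{|\mathcal A||\mathcal B|}\;\varepsilon(G).$$ The bound does not depend on $|\mathcal X|$ and $|\mathcal Y|$. In particular, for $|\mathcal A|=|\mathcal B|=1$ one has $\gamma_2^*(G)\le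 K\,\varepsilon(G)$, which is the usual Grothendieck inequality with Krivine's constant: if $(\alpha_{x,y})$ is a real matrix with $\big|\sum_{x,y}\alpha_{x,y}s_xt_y\big|\le C$ for all signs $s_x,t_y\in\{-1,1\}$, then $\big|\sum_{x,y}\alpha_{x,y}\langle u_x,v_y\rangle\big|\le K\,C$ for all vectors $u_x,v_y$ of norm at most $1$ in any real inner product space. -/

import Mathlib

open scoped TensorProduct ENNReal

noncomputable section

namespace HilbertianTensor

/-- The Banach space `ℓ_∞^X(ℓ_1^A)`, with norm `‖P‖ = max_x ∑_a |P x a|`. -/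
abbrev LinfL1 (X A : Type*) [Fintype X] [Fintype A] : Type _ :=
  PiLp ∞ (fun _ : X => PiLp 1 (fun _ : A => ℝ))

/-- The Banach space `ℓ_1^X(ℓ_∞^A)`, with norm `‖G‖ = ∑_x max_a |G x a|`. -/
abbrev L1Linf (X A : Type*) [Fintype X] [Fintype A] : Type _ :=
  PiLp 1 (fun _ : X => PiLp ∞ (fun _ : A => ℝ))

/-- The duality pairing `⟨G, P⟩ = ∑_{x,a} G x a * P x a` which identifies `ℓ_1^X(ℓ_∞^A)` with the
dual of `ℓ_∞^X(ℓ_1^A)`. -/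
def pairing (X A : Type*) [Fintype X] [Fintype A] :
    L1Linf X A →ₗ[ℝ] LinfL1 X A →ₗ[ℝ] ℝ :=
  LinearMap.mk₂ ℝ (fun G P => ∑ x, ∑ a, G x a * P x a)
    (fun G G' P => by simp [add_mul, Finset.sum_add_distrib])
    (fun c G P => by simp [mul_assoc, Finset.mul_sum])
    (fun G P P' => by simp [mul_add, Finset.sum_add_distrib])
    (fun c G P => by simp [mul_left_comm, Finset.mul_sum])

section

variable {X Y A B : Type*} [Fintype X] [Fintype Y] [Fintype A] [Fintype B]

/-- The pairing of the tensor product spaces, determined by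
`⟨G_A ⊗ G_B, P_A ⊗ P_B⟩ = ⟨G_A, P_A⟩ * ⟨G_B, P_B⟩`. -/
def tensorPairing :
    (L1Linf X A ⊗[ℝ] L1Linf Y B) →ₗ[ℝ] (LinfL1 X A ⊗[ℝ] LinfL1 Y B) →ₗ[ℝ] ℝ :=
  TensorProduct.dualDistrib ℝ (LinfL1 X A) (LinfL1 Y B) ∘ₗ
    TensorProduct.map (pairing X A) (pairing Y B)

theorem tensorPairing_tmul (GA : L1Linf X A) (GB : L1Linf Y B) (PA : LinfL1 X A)
    (PB : LinfL1 Y B) :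
    tensorPairing (GA ⊗ₜ[ℝ] GB) (PA ⊗ₜ[ℝ] PB) = pairing X A GA PA * pairing Y B GB PB := by
  simp [tensorPairing]

/-- The values whose supremum is the injective tensor norm of `G`. -/
def injectiveNormSet (G : L1Linf X A ⊗[ℝ] L1Linf Y B) : Set ℝ :=
  {r | ∃ (PA : LinfL1 X A) (PB : LinfL1 Y B), ‖PA‖ ≤ 1 ∧ ‖PB‖ ≤ 1 ∧
    r = |tensorPairing G (PA ⊗ₜ[ℝ] PB)|}

/-- The injective tensor norm
`ε(G) = sup {|⟨G, P_A ⊗ P_B⟩| : ‖P_A‖ ≤ 1, ‖P_B‖ ≤ 1}` on `ℓ_1^X(ℓ_∞^A) ⊗ ℓ_1^Y(ℓ_∞^B)`. -/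
def injectiveNorm (G : L1Linf X A ⊗[ℝ] L1Linf Y B) : ℝ := sSup (injectiveNormSet G)

/-- The weak `ℓ_2` norm `w_2(P_i) = sup {(∑ i, |⟨G, P_i⟩|²)^{1/2} : ‖G‖ ≤ 1}` of a finite family in
`ℓ_∞^X(ℓ_1^A)`, with `G` in the dual space `ℓ_1^X(ℓ_∞^A)`. -/
def weakL2 {n : ℕ} (P : Fin n → LinfL1 X A) : ℝ :=
  sSup {r | ∃ G : L1Linf X A, ‖G‖ ≤ 1 ∧ r = √(∑ i, |pairing X A G (P i)| ^ 2)}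

/-- The Hilbertian tensor norm `γ₂(P) = inf w_2(P_A^i) * w_2(P_B^i)` on
`ℓ_∞^X(ℓ_1^A) ⊗ ℓ_∞^Y(ℓ_1^B)`, over all finite decompositions `P = ∑ i, P_A^i ⊗ P_B^i`. -/
def gamma2 (P : LinfL1 X A ⊗[ℝ] LinfL1 Y B) : ℝ :=
  sInf {r | ∃ (n : ℕ) (PA : Fin n → LinfL1 X A) (PB : Fin n → LinfL1 Y B),
    P = ∑ i, PA i ⊗ₜ[ℝ] PB i ∧ r = weakL2 PA * weakL2 PB}

/-- The values whose supremum is the dual Hilbertian tensor norm of `G`. -/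
def gamma2DualSet (G : L1Linf X A ⊗[ℝ] L1Linf Y B) : Set ℝ :=
  {r | ∃ P : LinfL1 X A ⊗[ℝ] LinfL1 Y B, gamma2 P ≤ 1 ∧ r = |tensorPairing G P|}

/-- The dual Hilbertian tensor norm `γ₂*(G) = sup {|⟨G, P⟩| : γ₂(P) ≤ 1}` on
`ℓ_1^X(ℓ_∞^A) ⊗ ℓ_1^Y(ℓ_∞^B)`. -/
def gamma2Dual (G : L1Linf X A ⊗[ℝ] L1Linf Y B) : ℝ := sSup (gamma2DualSet G)

end

/-- Krivine's constant `π / (2 ln(1 + √2))`. -/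
def krivineConst : ℝ := Real.pi / (2 * Real.log (1 + √2))

end HilbertianTensor

end

/-! Write a tensor `P = ∑ k, PA k ⊗ PB k` through its entry vectors `u_{x,a} = (PA k x a)_k` and
`v_{y,b} = (PB k y b)_k`, so that `⟨G, P⟩ = ∑ G_{xa,yb} ⟨u_{x,a}, v_{y,b}⟩`. Normalising the vectors
and moving their lengths into the coefficients puts this in the scope of Grothendieck's inequality
(`abs_sum_mul_inner_le`). A sign sum of the new coefficients is `G` paired with the product of the
arrays `s ‖u‖` and `t ‖v‖`. Their norms are at most `√|A| w₂(PA)` and `√|B| w₂(PB)`: suitable signs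
give `∑ a, ‖u_{x,a}‖² ≤ w₂²` (`sum_norm_entryVec_sq_le`), and Cauchy–Schwarz costs the factor
`√|A|`. Hence sign sums are controlled by `ε(G)`, and the infimum over decompositions gives `γ₂`.

Grothendieck's inequality is proved by Krivine's method. With `c = log (1 + √2)`, the matrix with
blocks `sinh (c Q)` on the diagonal and `sin (c Q)` off it is again a correlation matrix. Signs of
Gaussians with this covariance have cross correlations `(2 / π) arcsin (sin (c Q i j)) = (2 c / π) Q
i j`, so averaging the sign bound yields the constant `π / (2 c)`. -/

/-- The integral of a function which is constant on the open interval. -/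
theorem intervalIntegral_eq_of_eqOn_const {f : ℝ → ℝ} {a b c : ℝ} (hab : a ≤ b)
    (h : ∀ x ∈ Set.Ioo a b, f x = c) : ∫ x in a..b, f x = c * (b - a) := by
  rw [intervalIntegral.integral_congr_Ioo_of_le (g := fun _ => c) hab h]
  simp [mul_comm]

/-! ### Grothendieck's identity for signs of correlated Gaussians. -/

namespace Grothendieck

/-- The sign of a real number, with values in `{1, -1}`; the sign of `0` is `1`. -/
noncomputable def signPM (x : ℝ) : ℝ := if 0 ≤ x then 1 else -1

theorem signPM_of_nonneg {x : ℝ} (h : 0 ≤ x) : signPM x = 1 := if_pos h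

theorem signPM_of_neg {x : ℝ} (h : x < 0) : signPM x = -1 := if_neg h.not_ge

theorem signPM_eq_or (x : ℝ) : signPM x = 1 ∨ signPM x = -1 := by
  unfold signPM; split_ifs <;> simp

theorem abs_signPM (x : ℝ) : |signPM x| = 1 := by
  rcases signPM_eq_or x with h | h <;> simp [h]

theorem signPM_mul_of_pos {r : ℝ} (hr : 0 < r) (x : ℝ) : signPM (r * x) = signPM x := by
  simp [signPM, mul_nonneg_iff_of_pos_left hr]

@[fun_prop]
theorem measurable_signPM : Measurable signPM :=
  Measurable.ite measurableSet_Ici measurable_const measurable_const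

open Real MeasureTheory

theorem integral_signPM_cos_mul_signPM_cos_sub {θ : ℝ} (h0 : 0 ≤ θ) (hπ : θ ≤ π) :
    ∫ φ in (-π)..π, signPM (cos φ) * signPM (cos (φ - θ)) = 2 * π - 4 * θ := by
  set f : ℝ → ℝ := fun φ => signPM (cos φ) * signPM (cos (φ - θ)) with hf
  have hper : Function.Periodic f (2 * π) := fun φ => by
    simp only [hf, cos_add_two_pi, show φ + 2 * π - θ = φ - θ + 2 * π by ring]
  have hint : ∀ a b, IntervalIntegrable f volume a b := fun a b => by
    refine (intervalIntegrable_const (c := (1 : ℝ))).mono_fun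
      (Measurable.aestronglyMeasurable (by fun_prop)) (ae_of_all _ fun x => ?_)
    simp [hf, abs_signPM]
  -- Starting the period at `-π / 2` puts the sign changes in the order `θ - π / 2 ≤ π / 2 ≤ θ + π /
  -- 2` for every `θ` in `[0, π]`.
  have hshift := hper.intervalIntegral_add_eq (-π) (-(π / 2))
  rw [show -π + 2 * π = π by ring, show -(π / 2) + 2 * π = 3 * π / 2 by ring] at hshift
  have hpi := pi_pos
  rw [hshift, ← intervalIntegral.integral_add_adjacent_intervals (hint (-(π / 2)) (θ - π / 2))
      (hint _ (3 * π / 2)),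
    ← intervalIntegral.integral_add_adjacent_intervals (hint (θ - π / 2) (π / 2))
      (hint _ (3 * π / 2)),
    ← intervalIntegral.integral_add_adjacent_intervals (hint (π / 2) (θ + π / 2))
      (hint _ (3 * π / 2)),
    intervalIntegral_eq_of_eqOn_const (c := -1) (by linarith),
    intervalIntegral_eq_of_eqOn_const (c := 1) (by linarith),
    intervalIntegral_eq_of_eqOn_const (c := -1) (by linarith),
    intervalIntegral_eq_of_eqOn_const (c := 1) (by linarith)]
  · ring
  · rintro x ⟨h1, h2⟩
    simp only [hf]
    rw [signPM_of_neg (cos_neg_of_pi_div_two_lt_of_lt (by linarith) (by linarith)),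
      signPM_of_neg (cos_neg_of_pi_div_two_lt_of_lt (by linarith) (by linarith))]
    norm_num
  · rintro x ⟨h1, h2⟩
    simp only [hf]
    rw [signPM_of_neg (cos_neg_of_pi_div_two_lt_of_lt (by linarith) (by linarith)),
      signPM_of_nonneg (cos_pos_of_mem_Ioo ⟨by linarith, by linarith⟩).le]
    norm_num
  · rintro x ⟨h1, h2⟩
    simp only [hf]
    rw [signPM_of_nonneg (cos_pos_of_mem_Ioo ⟨by linarith, by linarith⟩).le,
      signPM_of_nonneg (cos_pos_of_mem_Ioo ⟨by linarith, by linarith⟩).le]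
    norm_num
  · rintro x ⟨h1, h2⟩
    simp only [hf]
    rw [signPM_of_nonneg (cos_pos_of_mem_Ioo ⟨by linarith, by linarith⟩).le,
      ← cos_neg (x - θ),
      signPM_of_neg (cos_neg_of_pi_div_two_lt_of_lt (by linarith) (by linarith))]
    norm_num

theorem integral_mul_exp_neg_sq_div_two :
    ∫ r in Set.Ioi (0 : ℝ), r * exp (-r ^ 2 / 2) = 1 := by
  have h := integral_rpow_mul_exp_neg_mul_rpow (p := 2) (q := 1) (b := 1 / 2) (by norm_num)
    (by norm_num) (by norm_num)
  norm_num at h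
  rw [← h]
  refine setIntegral_congr_fun measurableSet_Ioi fun r _ => ?_
  ring_nf

open ProbabilityTheory

theorem integral_gaussianReal_prod (f : ℝ × ℝ → ℝ) :
    ∫ p, f p ∂((gaussianReal 0 1).prod (gaussianReal 0 1)) =
      ∫ p : ℝ × ℝ, (2 * π)⁻¹ * exp (-(p.1 ^ 2 + p.2 ^ 2) / 2) * f p := by
  rw [gaussianReal_of_var_ne_zero _ one_ne_zero,
    prod_withDensity (measurable_gaussianPDF _ _) (measurable_gaussianPDF _ _),
    integral_withDensity_eq_integral_toReal_smul
      (f := fun z : ℝ × ℝ => gaussianPDF 0 1 z.1 * gaussianPDF 0 1 z.2)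
      (by have := measurable_gaussianPDF 0 1; fun_prop)
      (ae_of_all _ fun p => ENNReal.mul_lt_top ENNReal.ofReal_lt_top ENNReal.ofReal_lt_top)]
  refine integral_congr_ae (ae_of_all _ fun p => ?_)
  simp only [ENNReal.toReal_mul, toReal_gaussianPDF, gaussianPDFReal, smul_eq_mul, sub_zero,
    NNReal.coe_one, mul_one]
  rw [show -(p.1 ^ 2 + p.2 ^ 2) / 2 = -p.1 ^ 2 / 2 + -p.2 ^ 2 / 2 by ring, exp_add]
  have : (√(2 * π))⁻¹ * (√(2 * π))⁻¹ = (2 * π)⁻¹ := by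
    rw [← mul_inv, mul_self_sqrt (by positivity)]
  rw [← this]; ring

/-- In polar coordinates the second argument is `r cos (φ - θ)`, so both signs depend on the angle
alone and the radial integral factors out. -/
theorem integral_signPM_mul_signPM_gaussianReal_prod {θ : ℝ} (h0 : 0 ≤ θ) (hπ : θ ≤ π) :
    ∫ p : ℝ × ℝ, signPM p.1 * signPM (cos θ * p.1 + sin θ * p.2)
      ∂((gaussianReal 0 1).prod (gaussianReal 0 1)) = 1 - 2 * θ / π := by
  rw [integral_gaussianReal_prod, ← integral_comp_polarCoord_symm]
  have : ∀ p ∈ polarCoord.target, p.1 • ((2 * π)⁻¹ *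
      exp (-((polarCoord.symm p).1 ^ 2 + (polarCoord.symm p).2 ^ 2) / 2) *
      (signPM (polarCoord.symm p).1 *
        signPM (cos θ * (polarCoord.symm p).1 + sin θ * (polarCoord.symm p).2))) =
      (p.1 * exp (-p.1 ^ 2 / 2)) *
        ((2 * π)⁻¹ * (signPM (cos p.2) * signPM (cos (p.2 - θ)))) := by
    rintro ⟨r, φ⟩ ⟨hr, -⟩
    simp only [polarCoord_symm_apply, smul_eq_mul]
    rw [signPM_mul_of_pos hr, show cos θ * (r * cos φ) + sin θ * (r * sin φ) = r * cos (φ - θ) by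
      rw [cos_sub]; ring, signPM_mul_of_pos hr,
      show (r * cos φ) ^ 2 + (r * sin φ) ^ 2 = r ^ 2 by
        linear_combination r ^ 2 * sin_sq_add_cos_sq φ]
    ring
  rw [setIntegral_congr_fun polarCoord.open_target.measurableSet this, polarCoord_target,
    Measure.volume_eq_prod, setIntegral_prod_mul (fun r => r * exp (-r ^ 2 / 2))
      (fun φ => (2 * π)⁻¹ * (signPM (cos φ) * signPM (cos (φ - θ)))),
    integral_mul_exp_neg_sq_div_two, ← integral_Ioc_eq_integral_Ioo,
    ← intervalIntegral.integral_of_le (by linarith [pi_pos]),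
    intervalIntegral.integral_const_mul, integral_signPM_cos_mul_signPM_cos_sub h0 hπ]
  field_simp
  ring

theorem charFunDual_gaussianReal_zero_one (L : StrongDual ℝ ℝ) :
    charFunDual (gaussianReal 0 1) L = Complex.exp (-((L 1) ^ 2 / 2 : ℝ)) := by
  have : charFunDual (gaussianReal 0 1) L = charFun (gaussianReal 0 1) (L 1) := by
    rw [charFunDual_apply, charFun_apply_real]
    congr with x
    rw [show L x = L 1 * x by simpa [mul_comm] using L.map_smul x 1]
    push_cast; ring_nf
  rw [this, charFun_gaussianReal]
  push_cast; simp

variable {κ : Type*} [Fintype κ] [DecidableEq κ]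

/-- Both characteristic functions at `(a, b)` equal `exp (-(a² + 2 a b cos θ + b²) / 2)`. This
covers singular `S`, where no density exists. -/
theorem map_pair_multivariateGaussian {S : Matrix κ κ ℝ} (hS : S.PosSemidef)
    (hd : ∀ k, S k k = 1) {i j : κ} {θ : ℝ} (hij : S i j = cos θ) :
    (multivariateGaussian 0 S).map (fun x => (x i, x j)) =
      ((gaussianReal 0 1).prod (gaussianReal 0 1)).map
        (fun p => (p.1, cos θ * p.1 + sin θ * p.2)) := by
  let T : EuclideanSpace ℝ κ →L[ℝ] ℝ × ℝ :=
    (EuclideanSpace.proj i).prod (EuclideanSpace.proj j)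
  let R : ℝ × ℝ →L[ℝ] ℝ × ℝ := (ContinuousLinearMap.fst ℝ ℝ ℝ).prod
    (cos θ • ContinuousLinearMap.fst ℝ ℝ ℝ + sin θ • ContinuousLinearMap.snd ℝ ℝ ℝ)
  change (multivariateGaussian 0 S).map T = ((gaussianReal 0 1).prod (gaussianReal 0 1)).map R
  refine Measure.ext_of_charFunDual (funext fun L => ?_)
  set a := L (1, 0) with ha
  set b := L (0, 1) with hb
  have hL : ∀ x y, L (x, y) = a * x + b * y := fun x y => by
    rw [show ((x, y) : ℝ × ℝ) = x • (1, 0) + y • (0, 1) by simp, map_add, map_smul, map_smul]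
    simp [ha, hb, mul_comm]
  have hji : S j i = cos θ := by rw [← hij]; simpa using hS.isHermitian.apply i j
  rw [charFunDual_map, charFunDual_map, charFunDual_prod, charFunDual_gaussianReal_zero_one,
    charFunDual_gaussianReal_zero_one]
  have h1 : charFunDual (multivariateGaussian 0 S) (L.comp T) =
      charFun (multivariateGaussian 0 S)
        (WithLp.toLp 2 (Pi.single i a + Pi.single j b)) := by
    rw [charFunDual_apply, charFun_apply]
    congr with x
    have : inner ℝ x (WithLp.toLp 2 (Pi.single i a + Pi.single j b)) = L (T x) := by
      simp [T, hL, PiLp.inner_apply, add_mul, Finset.sum_add_distrib]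
    rw [this]; simp
  rw [h1, charFun_multivariateGaussian hS, ← Complex.exp_add]
  congr 1
  have h2 : (Pi.single i a + Pi.single j b : κ → ℝ) ⬝ᵥ
      S.mulVec (Pi.single i a + Pi.single j b) = a ^ 2 + 2 * a * b * cos θ + b ^ 2 := by
    simp [Matrix.mulVec_add, add_dotProduct, hij, hji, hd]
    ring
  simp only [inner_zero_right, h2]
  have h3 : (sin θ : ℂ) ^ 2 + (cos θ : ℂ) ^ 2 = 1 := by exact_mod_cast sin_sq_add_cos_sq θ
  have h4 : L.comp R (1, 0) = a + b * cos θ := by simp [R, hL]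
  have h5 : L.comp R (0, 1) = b * sin θ := by simp [R, hL]
  simp only [ContinuousLinearMap.comp_apply, ContinuousLinearMap.inl_apply,
    ContinuousLinearMap.inr_apply] at h4 h5 ⊢
  rw [h4, h5]
  simp only [Complex.ofReal_add, Complex.ofReal_mul, Complex.ofReal_div, Complex.ofReal_pow,
    Complex.ofReal_ofNat, Complex.ofReal_zero, zero_mul, zero_sub]
  linear_combination (b : ℂ) ^ 2 / 2 * h3

/-- **Grothendieck's identity**. -/
theorem integral_signPM_mul_signPM_multivariateGaussian {S : Matrix κ κ ℝ} (hS : S.PosSemidef)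
    (hd : ∀ k, S k k = 1) {i j : κ} {θ : ℝ} (h0 : 0 ≤ θ) (hπ : θ ≤ π) (hij : S i j = cos θ) :
    ∫ x, signPM (x i) * signPM (x j) ∂(multivariateGaussian 0 S) = 1 - 2 * θ / π := by
  rw [← integral_signPM_mul_signPM_gaussianReal_prod h0 hπ]
  have hm : Measurable fun q : ℝ × ℝ => signPM q.1 * signPM q.2 := by fun_prop
  have h1 := integral_map (μ := multivariateGaussian 0 S) (φ := fun x => (x i, x j))
    (Measurable.aemeasurable (by fun_prop)) hm.aestronglyMeasurable
  have h2 := integral_map (μ := (gaussianReal 0 1).prod (gaussianReal 0 1))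
    (φ := fun p => (p.1, cos θ * p.1 + sin θ * p.2))
    (Measurable.aemeasurable (by fun_prop)) hm.aestronglyMeasurable
  rw [map_pair_multivariateGaussian hS hd hij] at h1
  exact h1.symm.trans h2

end Grothendieck

/-! ### Krivine's proof of Grothendieck's inequality. -/

namespace Grothendieck

open Real MeasureTheory ProbabilityTheory
open scoped Matrix Nat

/-- Iterated Schur product theorem. -/
theorem posSemidef_pow_entrywise {κ : Type*} {Q : Matrix κ κ ℝ} (hQ : Q.PosSemidef) (n : ℕ) :
    (Matrix.of fun a b => Q a b ^ (n + 1)).PosSemidef := by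
  induction n with
  | zero =>
    convert! hQ using 1
    ext a b
    simp
  | succ n ih =>
    convert! ih.hadamard hQ using 1

theorem posSemidef_of_hasSum {κ : Type*} [Fintype κ] {F : ℕ → Matrix κ κ ℝ} {S : Matrix κ κ ℝ}
    (hF : ∀ n, (F n).PosSemidef) (h : ∀ a b, HasSum (fun n => F n a b) (S a b)) :
    S.PosSemidef := by
  refine .of_dotProduct_mulVec_nonneg (Matrix.IsHermitian.ext fun a b => ?_) fun x => ?_
  · refine (h b a).unique ?_
    convert! h a b using 2 with n
    simpa using (hF n).isHermitian.apply a b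
  · have : HasSum (fun n => star x ⬝ᵥ (F n *ᵥ x)) (star x ⬝ᵥ (S *ᵥ x)) := by
      simp only [dotProduct, Matrix.mulVec]
      exact hasSum_sum fun a _ => (hasSum_sum fun b _ => (h a b).mul_right _).mul_left _
    exact this.nonneg fun n => (hF n).dotProduct_mulVec_nonneg x

theorem posSemidef_scale_entrywise {κ : Type*} [Fintype κ] {Q : Matrix κ κ ℝ}
    (hQ : Q.PosSemidef) (σ : κ → ℝ) : (Matrix.of fun a b => σ a * Q a b * σ b).PosSemidef := by
  classical
  convert! hQ.conjTranspose_mul_mul_same (Matrix.diagonal σ) using 1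
  ext a b
  simp

/-- The quadratic form at `e_i ± e_j` is `2 ± 2 Q i j`. -/
theorem abs_le_one_of_posSemidef {κ : Type*} [Fintype κ] {Q : Matrix κ κ ℝ}
    (hQ : Q.PosSemidef) (hd : ∀ k, Q k k = 1) (i j : κ) : |Q i j| ≤ 1 := by
  classical
  have hji : Q j i = Q i j := by simpa using hQ.isHermitian.apply i j
  have h (s : ℝ) := hQ.dotProduct_mulVec_nonneg (Pi.single i 1 + Pi.single j s)
  have h1 := h 1
  have h2 := h (-1)
  simp [Matrix.mulVec_add, add_dotProduct, hd, hji] at h1 h2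
  rw [abs_le]
  constructor <;> linarith

variable {I J : Type*} [Fintype I] [Fintype J]

/-- Krivine's transformation of a Gram matrix of two families of vectors: `sinh (c * ·)` within
each of the families and `sin (c * ·)` between them. -/
noncomputable def krivineMatrix (c : ℝ) (Q : Matrix (I ⊕ J) (I ⊕ J) ℝ) :
    Matrix (I ⊕ J) (I ⊕ J) ℝ :=
  Matrix.of fun a b => if a.isLeft = b.isLeft then sinh (c * Q a b) else sin (c * Q a b)

/-- The series of `sin` and `sinh` have the same odd terms up to the sign `(-1) ^ n`. Conjugating
the `n`-th term by the diagonal matrix `σ n` inserts this sign in the off-diagonal blocks only, so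
each term stays positive semidefinite. -/
theorem posSemidef_krivineMatrix {c : ℝ} (hc : 0 ≤ c) {Q : Matrix (I ⊕ J) (I ⊕ J) ℝ}
    (hQ : Q.PosSemidef) : (krivineMatrix c Q).PosSemidef := by
  let σ : ℕ → I ⊕ J → ℝ := fun n a => if a.isLeft then 1 else (-1) ^ n
  refine posSemidef_of_hasSum (F := fun n => (c ^ (2 * n + 1) / (2 * n + 1)! : ℝ) •
    Matrix.of fun a b => σ n a * Q a b ^ (2 * n + 1) * σ n b) (fun n => ?_) fun a b => ?_
  · exact (posSemidef_scale_entrywise (posSemidef_pow_entrywise hQ (2 * n)) (σ n)).smul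
      (by positivity)
  · have hsq (n : ℕ) : ((-1 : ℝ) ^ n) * (-1) ^ n = 1 := by
      rw [← mul_pow]; simp
    rcases a with a | a <;> rcases b with b | b
    · convert! Real.hasSum_sinh (c * Q (.inl a) (.inl b)) using 2 with n
      simp [σ, mul_pow]; ring
    · convert! Real.hasSum_sin (c * Q (.inl a) (.inr b)) using 2 with n
      simp [σ, mul_pow]; ring
    · convert! Real.hasSum_sin (c * Q (.inr a) (.inl b)) using 2 with n
      simp [σ, mul_pow]; ring
    · convert! Real.hasSum_sinh (c * Q (.inr a) (.inr b)) using 2 with n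
      simp [σ, mul_pow]
      linear_combination (c ^ (2 * n + 1) / (2 * n + 1)! * Q (.inr a) (.inr b) ^ (2 * n + 1)) *
        hsq n

theorem log_one_add_sqrt_two_pos : 0 < log (1 + √2) :=
  log_pos (by simp)

theorem sinh_log_one_add_sqrt_two : sinh (log (1 + √2)) = 1 := by
  have : log (1 + √2) = arsinh 1 := by rw [arsinh]; norm_num
  rw [this, sinh_arsinh]

/-- Keeps `c * Q i j` in `[-1, 1]`, where the arcsine inverts the sine. -/
theorem log_one_add_sqrt_two_lt_one : log (1 + √2) < 1 := by
  rw [← sinh_lt_sinh, sinh_log_one_add_sqrt_two]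
  exact self_lt_sinh_iff.2 one_pos

/-- **Grothendieck's inequality** with Krivine's constant, for the cross correlations of a
correlation matrix. -/
theorem sum_mul_correlation_le (M : I → J → ℝ) (C : ℝ)
    (hM : ∀ (s : I → ℝ) (t : J → ℝ), (∀ i, s i = 1 ∨ s i = -1) → (∀ j, t j = 1 ∨ t j = -1) →
      ∑ i, ∑ j, M i j * (s i * t j) ≤ C)
    {Q : Matrix (I ⊕ J) (I ⊕ J) ℝ} (hQ : Q.PosSemidef) (hd : ∀ k, Q k k = 1) :
    ∑ i, ∑ j, M i j * Q (.inl i) (.inr j) ≤ HilbertianTensor.krivineConst * C := by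
  classical
  set c := log (1 + √2) with hc
  have hc0 : 0 < c := log_one_add_sqrt_two_pos
  have hS := posSemidef_krivineMatrix hc0.le hQ
  set S := krivineMatrix c Q with hSdef
  -- The condition `sinh c = 1` is what determines `c`.
  have hSd : ∀ k, S k k = 1 := fun k => by
    simp [hSdef, krivineMatrix, hd, hc, sinh_log_one_add_sqrt_two]
  set μ := multivariateGaussian 0 S
  have hpi := pi_gt_three
  have hE (i : I) (j : J) : ∫ x, signPM (x (.inl i)) * signPM (x (.inr j)) ∂μ =
      2 * c / π * Q (.inl i) (.inr j) := by
    have hq := abs_le.1 (abs_le_one_of_posSemidef hQ hd (.inl i) (.inr j))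
    have hc1 : c < 1 := log_one_add_sqrt_two_lt_one
    have hlo : -1 ≤ c * Q (.inl i) (.inr j) := by nlinarith
    have hhi : c * Q (.inl i) (.inr j) ≤ 1 := by nlinarith
    -- For this `θ`, `cos θ = sin (c * Q i j)` is the entry of `S`, and `1 - 2 θ / π` is linear in
    -- `Q i j`.
    rw [integral_signPM_mul_signPM_multivariateGaussian hS hSd
      (θ := π / 2 - c * Q (.inl i) (.inr j)) (by linarith) (by linarith)
      (by simp [hSdef, krivineMatrix, cos_pi_div_two_sub])]
    field_simp
    ring
  have hint (i : I) (j : J) :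
      Integrable (fun x => M i j * (signPM (x (.inl i)) * signPM (x (.inr j)))) μ := by
    refine Integrable.const_mul ?_ _
    refine (integrable_const (1 : ℝ)).mono' (Measurable.aestronglyMeasurable (by fun_prop))
      (ae_of_all _ fun x => ?_)
    simp [abs_signPM]
  have key : 2 * c / π * ∑ i, ∑ j, M i j * Q (.inl i) (.inr j) ≤ C := by
    calc 2 * c / π * ∑ i, ∑ j, M i j * Q (.inl i) (.inr j)
        = ∫ x, ∑ i, ∑ j, M i j * (signPM (x (.inl i)) * signPM (x (.inr j))) ∂μ := by
          rw [integral_finsetSum _ fun i _ => integrable_finsetSum _ fun j _ => hint i j,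
            Finset.mul_sum]
          refine Finset.sum_congr rfl fun i _ => ?_
          rw [integral_finsetSum _ fun j _ => hint i j, Finset.mul_sum]
          refine Finset.sum_congr rfl fun j _ => ?_
          rw [integral_const_mul, hE]
          ring
      _ ≤ ∫ _, C ∂μ := by
          refine integral_mono (integrable_finsetSum _ fun i _ =>
            integrable_finsetSum _ fun j _ => hint i j) (integrable_const _) fun x => ?_
          exact hM _ _ (fun i => signPM_eq_or _) fun j => signPM_eq_or _
      _ = C := by simp
  have hK : HilbertianTensor.krivineConst = (2 * c / π)⁻¹ := by
    rw [HilbertianTensor.krivineConst, inv_div]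
  rw [hK, inv_mul_eq_div, le_div_iff₀ (by positivity), mul_comm]
  exact key

/-- **Grothendieck's inequality** with Krivine's constant. -/
theorem abs_sum_mul_inner_le (M : I → J → ℝ) (C : ℝ)
    (hM : ∀ (s : I → ℝ) (t : J → ℝ), (∀ i, s i = 1 ∨ s i = -1) → (∀ j, t j = 1 ∨ t j = -1) →
      |∑ i, ∑ j, M i j * (s i * t j)| ≤ C)
    {H : Type*} [NormedAddCommGroup H] [InnerProductSpace ℝ H] (u : I → H) (v : J → H)
    (hu : ∀ i, ‖u i‖ ≤ 1) (hv : ∀ j, ‖v j‖ ≤ 1) :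
    |∑ i, ∑ j, M i j * inner ℝ (u i) (v j)| ≤ HilbertianTensor.krivineConst * C := by
  classical
  let w : I ⊕ J → H := Sum.elim u v
  have hw : ∀ k, ‖w k‖ ≤ 1 := by rintro (i | j) <;> simp [w, hu, hv]
  -- The diagonal correction amounts to completing each vector to a unit vector in a new orthogonal
  -- direction of its own; cross inner products are unchanged.
  let Q : Matrix (I ⊕ J) (I ⊕ J) ℝ :=
    Matrix.gram ℝ w + Matrix.diagonal fun k => 1 - ‖w k‖ ^ 2
  have hQ : Q.PosSemidef := (Matrix.posSemidef_gram ℝ w).add <| .diagonal fun k => by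
    have := hw k
    have := norm_nonneg (w k)
    simp only [Pi.zero_apply]
    nlinarith
  have hd : ∀ k, Q k k = 1 := fun k => by simp [Q, Matrix.gram]
  have hQuv (i : I) (j : J) : Q (.inl i) (.inr j) = inner ℝ (u i) (v j) := by
    simp [Q, w, Matrix.gram]
  simp only [← hQuv]
  refine abs_le'.2 ⟨sum_mul_correlation_le M C (fun s t hs ht => (abs_le'.1 (hM s t hs ht)).1) hQ hd,
    ?_⟩
  have := sum_mul_correlation_le (fun i j => -M i j) C (fun s t hs ht => ?_) hQ hd
  · simpa only [neg_mul, Finset.sum_neg_distrib] using this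
  · simpa only [neg_mul, Finset.sum_neg_distrib] using (abs_le'.1 (hM s t hs ht)).2

end Grothendieck

/-! ### Reduction of the tensor inequality to Grothendieck's inequality. -/

namespace HilbertianTensor

open Finset

theorem krivineConst_nonneg : 0 ≤ krivineConst :=
  div_nonneg Real.pi_pos.le (mul_nonneg two_pos.le Grothendieck.log_one_add_sqrt_two_pos.le)

/-- Some choice of signs makes the signed sum of vectors at least as long as in the orthogonal
case. -/
theorem exists_signs_sum_sq_norm_le {ι H : Type*} [NormedAddCommGroup H] [InnerProductSpace ℝ H]
    (s : Finset ι) (u : ι → H) :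
    ∃ ε : ι → ℝ, (∀ a, ε a = 1 ∨ ε a = -1) ∧
      ∑ a ∈ s, ‖u a‖ ^ 2 ≤ ‖∑ a ∈ s, ε a • u a‖ ^ 2 := by
  classical
  induction s using Finset.induction_on with
  | empty => exact ⟨1, fun _ => .inl rfl, by simp⟩
  | insert a s ha ih =>
    obtain ⟨ε, hε, h⟩ := ih
    -- The new sign makes the cross term in the expanded square nonnegative.
    obtain ⟨δ, hδ, hpos⟩ : ∃ δ : ℝ, (δ = 1 ∨ δ = -1) ∧
        0 ≤ δ * inner ℝ (u a) (∑ b ∈ s, ε b • u b) := by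
      rcases le_total 0 (inner ℝ (u a) (∑ b ∈ s, ε b • u b)) with h0 | h0
      · exact ⟨1, .inl rfl, by simpa using h0⟩
      · exact ⟨-1, .inr rfl, by simpa using h0⟩
    refine ⟨Function.update ε a δ, fun b => ?_, ?_⟩
    · rcases eq_or_ne b a with rfl | hb
      · simpa using hδ
      · simpa [hb] using hε b
    · have hs : ∑ b ∈ s, Function.update ε a δ b • u b = ∑ b ∈ s, ε b • u b :=
        sum_congr rfl fun b hb => by
          rw [Function.update_of_ne (ne_of_mem_of_not_mem hb ha)]
      rw [sum_insert ha, sum_insert ha, hs, Function.update_self, norm_add_sq_real,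
        real_inner_smul_left, norm_smul]
      have : ‖δ‖ = 1 := by rcases hδ with rfl | rfl <;> simp
      rw [this]
      linarith

variable {X Y A B : Type*} [Fintype X] [Fintype Y] [Fintype A] [Fintype B]

theorem norm_linfL1_le_iff {P : LinfL1 X A} {c : ℝ} (hc : 0 ≤ c) :
    ‖P‖ ≤ c ↔ ∀ x, ∑ a, |P x a| ≤ c := by
  rw [PiLp.norm_eq_ciSup]
  have hx (x : X) : ‖P x‖ = ∑ a, |P x a| := by
    simp [PiLp.norm_eq_of_nat (p := 1) 1 (by simp)]
  simp only [hx]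
  exact ⟨fun h x => (le_ciSup (Set.finite_range fun x => ∑ a, |P x a|).bddAbove x).trans h,
    fun h => Real.iSup_le h hc⟩

theorem abs_apply_le_norm_linfL1 (P : LinfL1 X A) (x : X) (a : A) : |P x a| ≤ ‖P‖ :=
  (single_le_sum (f := fun a => |P x a|) (fun _ _ => abs_nonneg _) (mem_univ a)).trans
    ((norm_linfL1_le_iff (norm_nonneg P)).1 le_rfl x)

theorem abs_apply_le_norm_l1Linf (G : L1Linf X A) (x : X) (a : A) : |G x a| ≤ ‖G‖ :=
  (PiLp.norm_apply_le (G x) a).trans (PiLp.norm_apply_le G x)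

theorem pairing_apply (G : L1Linf X A) (P : LinfL1 X A) :
    pairing X A G P = ∑ x, ∑ a, G x a * P x a := rfl

/-- The element of `ℓ_∞^X(ℓ_1^A)` with the given entries. -/
def linfL1Of (p : X → A → ℝ) : LinfL1 X A :=
  WithLp.toLp ∞ fun x => WithLp.toLp 1 (p x)

@[simp]
theorem linfL1Of_apply (p : X → A → ℝ) (x : X) (a : A) : linfL1Of p x a = p x a := rfl

/-- The element of `ℓ_1^X(ℓ_∞^A)` with the given entries. -/
def l1LinfOf (g : X → A → ℝ) : L1Linf X A :=
  WithLp.toLp 1 fun x => WithLp.toLp ∞ (g x)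

@[simp]
theorem l1LinfOf_apply (g : X → A → ℝ) (x : X) (a : A) : l1LinfOf g x a = g x a := rfl

open Classical in
/-- The standard basis vectors of `ℓ_∞^X(ℓ_1^A)`. -/
noncomputable def linfL1Single (i : X × A) : LinfL1 X A :=
  linfL1Of fun x a => if i = (x, a) then 1 else 0

theorem eq_sum_linfL1Single (P : LinfL1 X A) :
    P = ∑ i : X × A, P i.1 i.2 • linfL1Single i := by
  classical
  ext x a
  simp [linfL1Single, Finset.sum_apply]

/-- The entries of a tensor `G`. -/
noncomputable def entry (G : L1Linf X A ⊗[ℝ] L1Linf Y B) (i : X × A) (j : Y × B) : ℝ :=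
  tensorPairing G (linfL1Single i ⊗ₜ[ℝ] linfL1Single j)

theorem tensorPairing_tmul_eq_sum (G : L1Linf X A ⊗[ℝ] L1Linf Y B) (P : LinfL1 X A)
    (Q : LinfL1 Y B) :
    tensorPairing G (P ⊗ₜ[ℝ] Q) =
      ∑ i : X × A, ∑ j : Y × B, entry G i j * (P i.1 i.2 * Q j.1 j.2) := by
  conv_lhs => rw [eq_sum_linfL1Single P, eq_sum_linfL1Single Q]
  simp only [TensorProduct.sum_tmul, TensorProduct.tmul_sum, TensorProduct.smul_tmul_smul,
    map_sum, map_smul, smul_eq_mul, entry]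
  rw [sum_comm]
  exact sum_congr rfl fun i _ => sum_congr rfl fun j _ => by ring

/-- The real `sSup` of an unbounded set is `0`, so boundedness is needed before `injectiveNorm`
dominates the individual values. -/
theorem bddAbove_injectiveNormSet (G : L1Linf X A ⊗[ℝ] L1Linf Y B) :
    BddAbove (injectiveNormSet G) := by
  refine ⟨∑ i : X × A, ∑ j : Y × B, |entry G i j|, ?_⟩
  rintro _ ⟨P, Q, hP, hQ, rfl⟩
  rw [tensorPairing_tmul_eq_sum]
  refine (abs_sum_le_sum_abs _ _).trans (sum_le_sum fun i _ =>
    (abs_sum_le_sum_abs _ _).trans (sum_le_sum fun j _ => ?_))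
  rw [abs_mul, abs_mul]
  have h1 := (abs_apply_le_norm_linfL1 P i.1 i.2).trans hP
  have h2 := (abs_apply_le_norm_linfL1 Q j.1 j.2).trans hQ
  exact mul_le_of_le_one_right (abs_nonneg _) (mul_le_one₀ h1 (abs_nonneg _) h2)

theorem injectiveNorm_nonneg (G : L1Linf X A ⊗[ℝ] L1Linf Y B) : 0 ≤ injectiveNorm G :=
  Real.sSup_nonneg (by rintro _ ⟨P, Q, -, -, rfl⟩; exact abs_nonneg _)

theorem abs_tensorPairing_tmul_le (G : L1Linf X A ⊗[ℝ] L1Linf Y B) (P : LinfL1 X A)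
    (Q : LinfL1 Y B) :
    |tensorPairing G (P ⊗ₜ[ℝ] Q)| ≤ ‖P‖ * ‖Q‖ * injectiveNorm G := by
  rcases eq_or_ne P 0 with rfl | hP
  · simp
  rcases eq_or_ne Q 0 with rfl | hQ
  · simp
  have h : |tensorPairing G ((‖P‖⁻¹ • P) ⊗ₜ[ℝ] (‖Q‖⁻¹ • Q))| ≤ injectiveNorm G :=
    le_csSup (bddAbove_injectiveNormSet G) ⟨_, _, (norm_smul_inv_norm hP).le,
      (norm_smul_inv_norm hQ).le, rfl⟩
  have hP' := norm_pos_iff.2 hP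
  have hQ' := norm_pos_iff.2 hQ
  rw [TensorProduct.smul_tmul_smul, map_smul, smul_eq_mul, abs_mul,
    abs_of_pos (by positivity), ← mul_inv, inv_mul_le_iff₀ (by positivity)] at h
  exact h

theorem sqrt_sum_sq_pairing_le_weakL2 {n : ℕ} (P : Fin n → LinfL1 X A) {G : L1Linf X A}
    (hG : ‖G‖ ≤ 1) : √(∑ i, |pairing X A G (P i)| ^ 2) ≤ weakL2 P := by
  refine le_csSup ⟨√(∑ i, (∑ x, ∑ a, |P i x a|) ^ 2), ?_⟩ ⟨G, hG, rfl⟩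
  rintro _ ⟨G, hG, rfl⟩
  refine Real.sqrt_le_sqrt (sum_le_sum fun i _ => ?_)
  gcongr
  rw [pairing_apply]
  refine (abs_sum_le_sum_abs _ _).trans (sum_le_sum fun x _ =>
    (abs_sum_le_sum_abs _ _).trans (sum_le_sum fun a _ => ?_))
  rw [abs_mul]
  exact mul_le_of_le_one_left (abs_nonneg _) ((abs_apply_le_norm_l1Linf G x a).trans hG)

theorem weakL2_nonneg {n : ℕ} (P : Fin n → LinfL1 X A) : 0 ≤ weakL2 P :=
  Real.sSup_nonneg (by rintro _ ⟨G, -, rfl⟩; exact Real.sqrt_nonneg _)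

/-- The vector of `(x, a)` entries of a finite family in `ℓ_∞^X(ℓ_1^A)`. -/
def entryVec {n : ℕ} (P : Fin n → LinfL1 X A) (x : X) (a : A) : EuclideanSpace ℝ (Fin n) :=
  WithLp.toLp 2 fun i => P i x a

/-- Test `weakL2` on the functional supported at `x` with the signs of
`exists_signs_sum_sq_norm_le`: it maps the family to the coordinates of `∑ a, ε a • u_{x,a}`. -/
theorem sum_norm_entryVec_sq_le {n : ℕ} (P : Fin n → LinfL1 X A) (x : X) :
    ∑ a, ‖entryVec P x a‖ ^ 2 ≤ weakL2 P ^ 2 := by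
  classical
  obtain ⟨ε, hε, h⟩ := exists_signs_sum_sq_norm_le univ (entryVec P x)
  have hε' (a : A) : |ε a| = 1 := by rcases hε a with h | h <;> simp [h]
  let G : L1Linf X A := l1LinfOf fun y a => if y = x then ε a else 0
  have hG : ‖G‖ ≤ 1 := by
    rw [PiLp.norm_eq_of_nat (p := 1) 1 (by simp), sum_eq_single x]
    · simp only [Nat.cast_one, pow_one, div_one, Real.rpow_one]
      rw [PiLp.norm_eq_ciSup]
      exact Real.iSup_le (fun a => by simp [G, hε']) zero_le_one
    · intro y _ hy
      rw [PiLp.norm_eq_ciSup]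
      simp [G, hy]
    · simp
  have hp (i : Fin n) : pairing X A G (P i) = (∑ a, ε a • entryVec P x a) i := by
    rw [pairing_apply, sum_eq_single x]
    · simp [G, entryVec]
    · intro y _ hy
      simp [G, hy]
    · simp
  have hw := sqrt_sum_sq_pairing_le_weakL2 P hG
  simp only [hp] at hw
  refine h.trans ?_
  rw [EuclideanSpace.norm_eq]
  simp only [Real.norm_eq_abs]
  gcongr

/-- Cauchy–Schwarz over `a`; the only source of the factor `√|A|`. -/
theorem sum_norm_entryVec_le {n : ℕ} (P : Fin n → LinfL1 X A) (x : X) :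
    ∑ a, ‖entryVec P x a‖ ≤ √(Fintype.card A) * weakL2 P := by
  have h := sq_sum_le_card_mul_sum_sq (s := univ) (f := fun a => ‖entryVec P x a‖)
  refine abs_le_of_sq_le_sq' ?_ (mul_nonneg (Real.sqrt_nonneg _) (weakL2_nonneg P)) |>.2
  rw [mul_pow, Real.sq_sqrt (Nat.cast_nonneg _)]
  refine h.trans ?_
  rw [card_univ]
  gcongr
  exact sum_norm_entryVec_sq_le P x

theorem abs_tensorPairing_sum_le (G : L1Linf X A ⊗[ℝ] L1Linf Y B) {n : ℕ}
    (P : Fin n → LinfL1 X A) (Q : Fin n → LinfL1 Y B) :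
    |tensorPairing G (∑ k, P k ⊗ₜ[ℝ] Q k)| ≤
      krivineConst * √((Fintype.card A : ℝ) * (Fintype.card B : ℝ)) * injectiveNorm G *
        (weakL2 P * weakL2 Q) := by
  let u : X × A → EuclideanSpace ℝ (Fin n) := fun i => entryVec P i.1 i.2
  let v : Y × B → EuclideanSpace ℝ (Fin n) := fun j => entryVec Q j.1 j.2
  -- For `w = 0` the convention `0⁻¹ = 0` gives the zero vector, which is also admissible.
  have hunit (w : EuclideanSpace ℝ (Fin n)) : ‖‖w‖⁻¹ • w‖ ≤ 1 := by
    rw [norm_smul, norm_inv, norm_norm]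
    exact inv_mul_le_one
  have hpair : tensorPairing G (∑ k, P k ⊗ₜ[ℝ] Q k) = ∑ i, ∑ j,
      entry G i j * ‖u i‖ * ‖v j‖ * inner ℝ (‖u i‖⁻¹ • u i) (‖v j‖⁻¹ • v j) := by
    have hrhs (i : X × A) (j : Y × B) : entry G i j * ‖u i‖ * ‖v j‖ *
        inner ℝ (‖u i‖⁻¹ • u i) (‖v j‖⁻¹ • v j) =
          ∑ k, entry G i j * (P k i.1 i.2 * Q k j.1 j.2) := by
      rw [← mul_sum, show ∑ k, P k i.1 i.2 * Q k j.1 j.2 = inner ℝ (u i) (v j) by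
        simp [u, v, entryVec, PiLp.inner_apply, mul_comm]]
      rcases eq_or_ne (u i) 0 with h | h
      · simp [h]
      rcases eq_or_ne (v j) 0 with h' | h'
      · simp [h']
      rw [real_inner_smul_left, real_inner_smul_right]
      have := norm_ne_zero_iff.2 h
      have := norm_ne_zero_iff.2 h'
      field_simp
    simp only [hrhs, map_sum, tensorPairing_tmul_eq_sum]
    rw [sum_comm]
    exact sum_congr rfl fun i _ => sum_comm
  have hK := Grothendieck.abs_sum_mul_inner_le (fun i j => entry G i j * ‖u i‖ * ‖v j‖)
    (√(Fintype.card A) * weakL2 P * (√(Fintype.card B) * weakL2 Q) * injectiveNorm G)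
    (fun s t hs ht => ?_) (fun i => ‖u i‖⁻¹ • u i) (fun j => ‖v j‖⁻¹ • v j)
    (fun i => hunit _) (fun j => hunit _)
  · rw [hpair]
    refine hK.trans_eq ?_
    rw [Real.sqrt_mul (Nat.cast_nonneg _)]
    ring
  · have hs' (i) : |s i| = 1 := by rcases hs i with h | h <;> simp [h]
    have ht' (j) : |t j| = 1 := by rcases ht j with h | h <;> simp [h]
    -- The lengths and signs are absorbed into one elementary tensor, which turns the sign sum into
    -- a value controlled by `injectiveNorm`.
    have h := abs_tensorPairing_tmul_le G (linfL1Of fun x a => s (x, a) * ‖u (x, a)‖)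
      (linfL1Of fun y b => t (y, b) * ‖v (y, b)‖)
    have hP : ‖linfL1Of fun x a => s (x, a) * ‖u (x, a)‖‖ ≤ √(Fintype.card A) * weakL2 P := by
      refine (norm_linfL1_le_iff (mul_nonneg (Real.sqrt_nonneg _) (weakL2_nonneg P))).2 fun x => ?_
      simpa [abs_mul, hs'] using sum_norm_entryVec_le P x
    have hQ : ‖linfL1Of fun y b => t (y, b) * ‖v (y, b)‖‖ ≤ √(Fintype.card B) * weakL2 Q := by
      refine (norm_linfL1_le_iff (mul_nonneg (Real.sqrt_nonneg _) (weakL2_nonneg Q))).2 fun y => ?_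
      simpa [abs_mul, ht'] using sum_norm_entryVec_le Q y
    rw [tensorPairing_tmul_eq_sum] at h
    have hsum : ∑ i, ∑ j, entry G i j * ‖u i‖ * ‖v j‖ * (s i * t j) = ∑ i : X × A, ∑ j : Y × B,
        entry G i j * (linfL1Of (fun x a => s (x, a) * ‖u (x, a)‖) i.1 i.2 *
          linfL1Of (fun y b => t (y, b) * ‖v (y, b)‖) j.1 j.2) :=
      sum_congr rfl fun i _ => sum_congr rfl fun j _ => by
        simp only [linfL1Of_apply, Prod.mk.eta]
        ring
    rw [hsum]
    refine h.trans ?_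
    have := injectiveNorm_nonneg G
    have := mul_nonneg (Real.sqrt_nonneg (Fintype.card A)) (weakL2_nonneg P)
    gcongr

/-- Makes the set under the infimum in `gamma2` nonempty, so that the infimum is approximated by
actual decompositions. -/
theorem exists_eq_sum_tmul (P : LinfL1 X A ⊗[ℝ] LinfL1 Y B) :
    ∃ (n : ℕ) (PA : Fin n → LinfL1 X A) (PB : Fin n → LinfL1 Y B),
      P = ∑ i, PA i ⊗ₜ[ℝ] PB i := by
  induction P using TensorProduct.induction_on with
  | zero => exact ⟨0, 0, 0, by simp⟩
  | tmul p q => exact ⟨1, fun _ => p, fun _ => q, by simp⟩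
  | add P Q hP hQ =>
    obtain ⟨n, a, b, rfl⟩ := hP
    obtain ⟨m, c, d, rfl⟩ := hQ
    exact ⟨n + m, Fin.append a c, Fin.append b d, by simp [Fin.sum_univ_add]⟩

theorem abs_tensorPairing_le_mul_gamma2 (G : L1Linf X A ⊗[ℝ] L1Linf Y B)
    (P : LinfL1 X A ⊗[ℝ] LinfL1 Y B) :
    |tensorPairing G P| ≤
      krivineConst * √((Fintype.card A : ℝ) * (Fintype.card B : ℝ)) * injectiveNorm G *
        gamma2 P := by
  set c := krivineConst * √((Fintype.card A : ℝ) * (Fintype.card B : ℝ)) * injectiveNorm G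
  have hc : 0 ≤ c := mul_nonneg (mul_nonneg krivineConst_nonneg (Real.sqrt_nonneg _))
    (injectiveNorm_nonneg G)
  refine le_of_forall_pos_le_add fun δ hδ => ?_
  obtain ⟨n₀, PA₀, PB₀, h₀⟩ := exists_eq_sum_tmul P
  -- The slack `δ / (c + 1)` costs at most `δ` after multiplication by `c`, and stays meaningful
  -- when `c = 0`.
  obtain ⟨_, ⟨n, PA, PB, rfl, rfl⟩, hr⟩ := exists_lt_of_csInf_lt
    (⟨_, n₀, PA₀, PB₀, h₀, rfl⟩ : {r | ∃ (n : ℕ) (PA : Fin n → LinfL1 X A)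
      (PB : Fin n → LinfL1 Y B), P = ∑ i, PA i ⊗ₜ[ℝ] PB i ∧
        r = weakL2 PA * weakL2 PB}.Nonempty)
    (show gamma2 P < gamma2 P + δ / (c + 1) from lt_add_of_pos_right _ (by positivity))
  refine (abs_tensorPairing_sum_le G PA PB).trans
    ((mul_le_mul_of_nonneg_left hr.le hc).trans ?_)
  rw [mul_add]
  gcongr
  rw [mul_div_assoc', div_le_iff₀ (by positivity)]
  nlinarith

theorem le_of_mem_gamma2DualSet {G : L1Linf X A ⊗[ℝ] L1Linf Y B} {r : ℝ}
    (hr : r ∈ gamma2DualSet G) :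
    r ≤ krivineConst * √((Fintype.card A : ℝ) * (Fintype.card B : ℝ)) * injectiveNorm G := by
  obtain ⟨P, hP, rfl⟩ := hr
  refine (abs_tensorPairing_le_mul_gamma2 G P).trans (mul_le_of_le_one_right ?_ hP)
  exact mul_nonneg (mul_nonneg krivineConst_nonneg (Real.sqrt_nonneg _)) (injectiveNorm_nonneg G)

theorem gamma2Dual_le (G : L1Linf X A ⊗[ℝ] L1Linf Y B) :
    gamma2Dual G ≤
      krivineConst * √((Fintype.card A : ℝ) * (Fintype.card B : ℝ)) * injectiveNorm G :=
  Real.sSup_le (fun _ => le_of_mem_gamma2DualSet) <|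
    mul_nonneg (mul_nonneg krivineConst_nonneg (Real.sqrt_nonneg _)) (injectiveNorm_nonneg G)

end HilbertianTensor

theorem theorem1 {X Y A B : Type*} [Fintype X] [Fintype Y] [Fintype A] [Fintype B] :
    -- the generalized inequality; the set whose supremum is `gamma2Dual G` is bounded
    (∀ G : HilbertianTensor.L1Linf X A ⊗[ℝ] HilbertianTensor.L1Linf Y B,
      BddAbove (HilbertianTensor.gamma2DualSet G) ∧
        HilbertianTensor.gamma2Dual G ≤
          HilbertianTensor.krivineConst * √((Fintype.card A : ℝ) * (Fintype.card B : ℝ)) *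
            HilbertianTensor.injectiveNorm G) ∧
    -- the case of one output on each side: the usual Grothendieck inequality
    (Fintype.card A = 1 → Fintype.card B = 1 →
      (∀ G : HilbertianTensor.L1Linf X A ⊗[ℝ] HilbertianTensor.L1Linf Y B,
        HilbertianTensor.gamma2Dual G ≤
          HilbertianTensor.krivineConst * HilbertianTensor.injectiveNorm G) ∧
      (∀ (α : X → Y → ℝ) (C : ℝ),
        (∀ (s : X → ℝ) (t : Y → ℝ), (∀ x, s x = 1 ∨ s x = -1) → (∀ y, t y = 1 ∨ t y = -1) →
          |∑ x, ∑ y, α x y * (s x * t y)| ≤ C) →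
        ∀ {H : Type*} [NormedAddCommGroup H] [InnerProductSpace ℝ H] (u : X → H) (v : Y → H),
          (∀ x, ‖u x‖ ≤ 1) → (∀ y, ‖v y‖ ≤ 1) →
          |∑ x, ∑ y, α x y * inner ℝ (u x) (v y)| ≤ HilbertianTensor.krivineConst * C)) := by
  refine ⟨fun G => ⟨⟨_, fun _ => HilbertianTensor.le_of_mem_gamma2DualSet⟩,
    HilbertianTensor.gamma2Dual_le G⟩, fun hA hB => ⟨fun G => ?_, fun α C hα => ?_⟩⟩
  · simpa [hA, hB] using HilbertianTensor.gamma2Dual_le G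
  · intro H _ _ u v hu hv
    exact Grothendieck.abs_sum_mul_inner_le α C hα u v hu hv
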